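/- Let $G$ be a finite simple graph. Call $G$ strongly chordal if every cycle of length at least $4$ in $G$ has a chord (an edge of $G$ joining two vertices of the cycle that are not consecutive on it), and moreover every cycle of even length at least $6$ has a chord whose endpoints have odd distance along the cycle. Let $T$ be a finite tree with a root and with positive integer weights on its arcs, and let the depth of a node of $T$ be the sum of the weights of the arcs on the path from that node to the root. For subtrees $T_1,T_2$ of $T$ (nonempty, identified with their node sets) say that $T_1$ overshadows $T_2$ if every node of $T_2\setminus T_1$ has strictly larger depth than every node of $T_2\cap T_1$. A family of subtrees of $T$ is compatible if for every two of its members at least one overshadows the other. **Theorem (Farber).** $G$ is strongly chordal if and only if it is the intersection graph of a compatible family of subtrees of a rooted weighted tree, i.e. if and only if there are such a tree $T$ and a compatible family $(T(v))_{v\in V(G)}$ of subtrees of $T$ such that any two distinct vertices $u,v$ of $G$ are adjacent exactly when $T(u)\cap T(v)\neq\emptyset$. -/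

import Mathlib

/-- The distance, along a closed walk of length `n`, between its positions `i ≤ j < n`: the number
of edges of the shorter of the two arcs joining them. -/
def cycleDist (n i j : ℕ) : ℕ := min (j - i) (n - (j - i))

/-- `G` is chordal: every cycle of length at least 4 has a chord, that is, an edge of `G` joining
two vertices of the cycle that are not consecutive on it. -/
def IsChordal {V : Type*} (G : SimpleGraph V) : Prop :=
  ∀ (v : V) (c : G.Walk v v), c.IsCycle → 4 ≤ c.length →
    ∃ i j : ℕ, i < j ∧ j < c.length ∧ G.Adj (c.getVert i) (c.getVert j) ∧
      2 ≤ cycleDist c.length i j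

/-- `G` is strongly chordal: it is chordal, and every cycle of even length at least 6 has a chord
whose ends have odd distance along the cycle. -/
def IsStronglyChordal {V : Type*} (G : SimpleGraph V) : Prop :=
  IsChordal G ∧
  ∀ (v : V) (c : G.Walk v v), c.IsCycle → Even c.length → 6 ≤ c.length →
    ∃ i j : ℕ, i < j ∧ j < c.length ∧ G.Adj (c.getVert i) (c.getVert j) ∧
      2 ≤ cycleDist c.length i j ∧ Odd (cycleDist c.length i j)

/-- A rooted tree on the node type `N` with positive integer weights on its arcs. The values of
`weight` outside the arc set play no role. -/
structure RootedWeightedTree (N : Type*) where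
  graph : SimpleGraph N
  isTree : graph.IsTree
  root : N
  weight : Sym2 N → ℕ
  weight_pos : ∀ e ∈ graph.edgeSet, 0 < weight e

namespace RootedWeightedTree

/-- The unique path from the node `x` to the root. -/
noncomputable def pathToRoot {N : Type*} (T : RootedWeightedTree N) (x : N) :
    T.graph.Walk x T.root :=
  (T.isTree.existsUnique_path x T.root).choose

/-- The depth of a node: the sum of the arc weights on the path from the node to the root. -/
noncomputable def depth {N : Type*} (T : RootedWeightedTree N) (x : N) : ℕ :=
  ((T.pathToRoot x).edges.map T.weight).sum

/-- `S` is the node set of a (nonempty) subtree of `T`. -/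
def IsSubtree {N : Type*} (T : RootedWeightedTree N) (S : Set N) : Prop :=
  (T.graph.induce S).IsTree

/-- `S₁` overshadows `S₂`: all nodes of `S₂ \ S₁` are strictly farther away from the root than all
nodes of `S₂ ∩ S₁`. -/
def Overshadows {N : Type*} (T : RootedWeightedTree N) (S₁ S₂ : Set N) : Prop :=
  ∀ x ∈ S₂ \ S₁, ∀ y ∈ S₂ ∩ S₁, T.depth y < T.depth x

/-- A family of node sets is compatible if of any two members one overshadows the other. -/
def IsCompatible {N V : Type*} (T : RootedWeightedTree N) (R : V → Set N) : Prop :=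
  ∀ u v : V, T.Overshadows (R u) (R v) ∨ T.Overshadows (R v) (R u)

/-- The family `R` is a tree representation of `G` with host tree `T`: all its members are
subtrees of `T`, and `G` is their intersection graph. -/
def IsTreeRepresentation {N V : Type*} (T : RootedWeightedTree N) (G : SimpleGraph V)
    (R : V → Set N) : Prop :=
  (∀ v : V, T.IsSubtree (R v)) ∧
  ∀ u v : V, G.Adj u v ↔ u ≠ v ∧ (R u ∩ R v).Nonempty

end RootedWeightedTree

/-! Cycles and trees are linked by strong elimination orderings: orderings for which the closed
adjacency matrix `M` never has ones at `(i, k)`, `(i, l)`, `(j, k)` and a zero at `(j, l)` with `i <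
j` and `k < l`.

From graph to tree, an ordering maximising `wᵀ M w`, where `w` consists of powers of two, has
lexicographically increasing rows (`exists_isLexOrdering`). A forbidden submatrix would then grow
into ever longer staircases (`IsStaircase.exists_succ`), since a staircase that closes up
contradicts strong chordality (`not_exists_alternating_cycle`); finiteness excludes this. Given a
strong elimination ordering, the parent of a vertex is its first later neighbour, with an extra root
for vertices that have none, and `v` is represented by its closed neighbours up to `v` itself.

From tree to graph, a vertex is ranked by the depth of the top node of its subtree. Compatibility
makes the closed neighbourhoods of the two cycle neighbours of a vertex of maximal rank nested on
the cycle, which yields chords spanning two and three edges (`isStronglyChordal_of_rank`). -/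

namespace SimpleGraph

variable {V : Type*} {G : SimpleGraph V}

/-! ### Cycles as vertex sequences -/

theorem exists_walk_of_sequence (f : ℕ → V) (n : ℕ) (h : ∀ i < n, G.Adj (f i) (f (i + 1))) :
    ∃ w : G.Walk (f 0) (f n), w.length = n ∧ ∀ i ≤ n, w.getVert i = f i := by
  induction n generalizing f with
  | zero => exact ⟨.nil, rfl, by simp⟩
  | succ n ih =>
    obtain ⟨w, hw, hf⟩ := ih (fun i => f (i + 1)) fun i hi => h (i + 1) (by omega)
    refine ⟨.cons (h 0 (by omega)) w, by simp [hw], fun i hi => ?_⟩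
    cases i with
    | zero => simp
    | succ i => rw [Walk.getVert_cons_succ, hf i (by omega)]

theorem exists_isCycle_of_sequence {f : ℕ → V} {n : ℕ} (hn : 3 ≤ n)
    (hinj : ∀ i j, i < j → j < n → f i ≠ f j) (hadj : ∀ i, i + 1 < n → G.Adj (f i) (f (i + 1)))
    (hlast : G.Adj (f (n - 1)) (f 0)) :
    ∃ (v : V) (c : G.Walk v v), c.IsCycle ∧ c.length = n ∧ ∀ i < n, c.getVert i = f i := by
  -- Rotated by one, the path ends at `f 0`; prepending the edge from `f 0` to `f 1` puts `f i` at
  -- position `i` of the cycle.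
  set g : ℕ → V := fun i => if i + 1 < n then f (i + 1) else f 0 with hg
  have hglt : ∀ i, i + 1 < n → g i = f (i + 1) := fun i hi => by simp [hg, hi]
  have hglast : g (n - 1) = f 0 := by simp [hg, show ¬ n - 1 + 1 < n by omega]
  obtain ⟨w, hw, hwg⟩ := exists_walk_of_sequence (G := G) g (n - 1) fun i hi => by
    rw [hglt i (by omega)]
    by_cases h : i + 1 + 1 < n
    · rw [hglt (i + 1) h]; exact hadj _ h
    · have : i + 1 = n - 1 := by omega
      rw [this, hglast]; exact hlast
  have hpath : w.IsPath := by
    rw [← Walk.IsPath.getVert_injOn_iff]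
    intro i hi j hj hij
    simp only [Set.mem_ofPred_eq, hw] at hi hj
    rw [hwg i hi, hwg j hj] at hij
    by_contra hne
    have key : ∀ i j, i < j → j ≤ n - 1 → g i ≠ g j := by
      intro i j hij hj
      rw [hglt i (by omega)]
      by_cases h : j + 1 < n
      · rw [hglt j h]; exact hinj _ _ (by omega) h
      · have : j = n - 1 := by omega
        rw [this, hglast]; exact (hinj 0 (i + 1) (by omega) (by omega)).symm
    rcases lt_or_gt_of_ne hne with h | h
    · exact key i j h hj hij
    · exact key j i h hi hij.symm
  have h0 : G.Adj (g (n - 1)) (g 0) := by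
    rw [hglast, hglt 0 (by omega)]; exact hadj 0 (by omega)
  refine ⟨g (n - 1), .cons h0 w, ?_, by simp [hw]; omega, fun i hi => ?_⟩
  · rw [Walk.cons_isCycle_iff]
    refine ⟨hpath, fun he => ?_⟩
    rw [Sym2.eq_swap] at he
    have := hpath.length_eq_one_of_mem_edges he
    omega
  · cases i with
    | zero => rw [Walk.getVert_zero, hglast]
    | succ i => rw [Walk.getVert_cons_succ, hwg i (by omega), hglt i hi]

theorem mod_add_cases {n : ℕ} (hn : 0 < n) (a d : ℕ) (hd : d < n) :
    (a % n + d < n ∧ (a + d) % n = a % n + d) ∨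
      (n ≤ a % n + d ∧ (a + d) % n + n = a % n + d) := by
  have h1 : (a + d) % n = (a % n + d) % n := by simp [Nat.add_mod]
  have h2 := Nat.mod_lt a hn
  rcases lt_or_ge (a % n + d) n with h | h
  · exact Or.inl ⟨h, by rw [h1, Nat.mod_eq_of_lt h]⟩
  · refine Or.inr ⟨h, ?_⟩
    rw [h1, Nat.mod_eq_sub_mod h, Nat.mod_eq_of_lt (by omega)]
    omega

namespace Walk

variable {v : V} {c : G.Walk v v}

/-- The vertices of a closed walk, as a periodic sequence. -/
def cyclicVert (c : G.Walk v v) (i : ℕ) : V := c.getVert (i % c.length)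

theorem IsCycle.cyclicVert_ne (hc : c.IsCycle) (a : ℕ) {d : ℕ} (hd : 0 < d) (hdn : d < c.length) :
    c.cyclicVert a ≠ c.cyclicVert (a + d) := by
  intro h
  have h3 := hc.three_le_length
  have h1 := Nat.mod_lt a (show 0 < c.length by omega)
  have h2 := Nat.mod_lt (a + d) (show 0 < c.length by omega)
  have := hc.getVert_injOn' (Set.mem_ofPred.2 (Nat.le_sub_one_of_lt h1))
    (Set.mem_ofPred.2 (Nat.le_sub_one_of_lt h2)) h
  have := mod_add_cases (show 0 < c.length by omega) a d hdn
  omega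

theorem cyclicVert_of_le {i : ℕ} (hi : i ≤ c.length) : c.getVert i = c.cyclicVert i := by
  rcases hi.lt_or_eq with h | h
  · rw [cyclicVert, Nat.mod_eq_of_lt h]
  · rw [cyclicVert, h, Nat.mod_self, getVert_length, getVert_zero]

theorem IsCycle.adj_cyclicVert (hc : c.IsCycle) (a : ℕ) :
    G.Adj (c.cyclicVert a) (c.cyclicVert (a + 1)) := by
  have h3 := hc.three_le_length
  have h1 := Nat.mod_lt a (show 0 < c.length by omega)
  have h2 : c.cyclicVert (a + 1) = c.getVert (a % c.length + 1) := by
    rw [cyclicVert_of_le (by omega), cyclicVert, cyclicVert]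
    congr 1
    simp
  rw [h2]
  exact c.adj_getVert_succ h1

theorem exists_chord_of_adj_cyclicVert (c : G.Walk v v) {a d : ℕ} (hd : d < c.length)
    (hd0 : 0 < d) (h : G.Adj (c.cyclicVert a) (c.cyclicVert (a + d))) :
    ∃ i j : ℕ, i < j ∧ j < c.length ∧ G.Adj (c.getVert i) (c.getVert j) ∧
      cycleDist c.length i j = min d (c.length - d) := by
  have h1 := Nat.mod_lt a (show 0 < c.length by omega)
  have h2 := Nat.mod_lt (a + d) (show 0 < c.length by omega)
  unfold cycleDist
  rcases mod_add_cases (show 0 < c.length by omega) a d hd with ⟨h3, h4⟩ | ⟨h3, h4⟩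
  · exact ⟨_, _, by omega, h2, h, by omega⟩
  · exact ⟨_, _, by omega, h1, h.symm, by omega⟩

end Walk

/-- A vertex of least rank on a cycle would have two distinct neighbours of larger rank. -/
theorem isAcyclic_of_rank {f : V → ℕ} (hf : ∀ u v, G.Adj u v → f u ≠ f v)
    (hup : ∀ u v w, G.Adj u v → G.Adj u w → f u < f v → f u < f w → v = w) : G.IsAcyclic := by
  intro v c hc
  have h3 := hc.three_le_length
  obtain ⟨m, hm, hmin⟩ := Finset.exists_min_image (Finset.range c.length)
    (fun i => f (c.cyclicVert i)) ⟨0, by simp; omega⟩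
  have hmin' : ∀ i, f (c.cyclicVert m) ≤ f (c.cyclicVert i) := fun i => by
    have := hmin (i % c.length) (by simpa using Nat.mod_lt _ (by omega))
    simpa [Walk.cyclicVert] using this
  have hper : c.cyclicVert (m + (c.length - 1) + 1) = c.cyclicVert m := by
    rw [Walk.cyclicVert, show m + (c.length - 1) + 1 = m + c.length by omega, Nat.add_mod_right]
    rfl
  have ha := hc.adj_cyclicVert m
  have hb := hc.adj_cyclicVert (m + (c.length - 1))
  rw [hper] at hb
  have hne := hc.cyclicVert_ne (m + 1) (d := c.length - 2) (by omega) (by omega)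
  rw [show m + 1 + (c.length - 2) = m + (c.length - 1) by omega] at hne
  exact hne (hup _ _ _ ha hb.symm (lt_of_le_of_ne (hmin' _) (hf _ _ ha))
    (lt_of_le_of_ne (hmin' _) (hf _ _ hb.symm)))

/-! ### Closed adjacency and the rank criterion -/

/-- The reflexive closure of adjacency. -/
def ClosedAdj (G : SimpleGraph V) (u v : V) : Prop := u = v ∨ G.Adj u v

theorem ClosedAdj.refl (G : SimpleGraph V) (u : V) : G.ClosedAdj u u := Or.inl rfl

theorem ClosedAdj.symm {u v : V} (h : G.ClosedAdj u v) : G.ClosedAdj v u :=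
  h.imp Eq.symm Adj.symm

theorem closedAdj_comm {u v : V} : G.ClosedAdj u v ↔ G.ClosedAdj v u := ⟨.symm, .symm⟩

theorem ClosedAdj.adj {u v : V} (h : G.ClosedAdj u v) (hne : u ≠ v) : G.Adj u v :=
  h.resolve_left hne

/-- If the closed neighbourhoods of the neighbours of a vertex are nested, up to vertices of larger
rank, then the graph is strongly chordal. -/
theorem isStronglyChordal_of_rank {f : V → ℕ}
    (hf : ∀ v u w, G.Adj v u → G.Adj v w → f u ≤ f v → f w ≤ f v →
      (∀ x, f x ≤ f v → G.ClosedAdj x w → G.ClosedAdj x u) ∨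
      (∀ x, f x ≤ f v → G.ClosedAdj x u → G.ClosedAdj x w)) : IsStronglyChordal G := by
  have key : ∀ (v : V) (c : G.Walk v v), c.IsCycle → 4 ≤ c.length →
      (∃ a, G.Adj (c.cyclicVert a) (c.cyclicVert (a + 2))) ∧
      (5 ≤ c.length → ∃ a, G.Adj (c.cyclicVert a) (c.cyclicVert (a + 3))) := by
    intro v c hc h4
    obtain ⟨m, hm, hmax⟩ := Finset.exists_max_image (Finset.range c.length)
      (fun i => f (c.cyclicVert i)) ⟨0, by simp; omega⟩
    -- Adding a period to the position of the maximum leaves room for the positions before it.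
    have hmax' : ∀ i, f (c.cyclicVert i) ≤ f (c.cyclicVert (m + c.length)) := fun i => by
      have := hmax (i % c.length) (by simpa using Nat.mod_lt _ (by omega))
      simpa [Walk.cyclicVert] using this
    obtain ⟨b, hb⟩ : ∃ b, m + c.length = b + 2 := ⟨m + c.length - 2, by omega⟩
    rw [hb] at hmax'
    have hadj := hc.adj_cyclicVert
    have h13 := hc.cyclicVert_ne (b + 1) (d := 2) (by omega) (by omega)
    -- Nestedness is applied to the neighbour at the smaller neighbourhood itself (span two) and to
    -- the next vertex of the cycle beyond it (span three).
    rcases hf _ _ _ (hadj (b + 1)).symm (hadj (b + 2)) (hmax' _) (hmax' _) with h | h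
    · refine ⟨⟨b + 1, ((h _ (hmax' _) (.refl _ _)).adj h13.symm).symm⟩, fun h5 => ⟨b + 1, ?_⟩⟩
      have := h _ (hmax' _) (Or.inr (hadj (b + 3)).symm)
      exact (this.adj (hc.cyclicVert_ne (b + 1) (d := 3) (by omega) (by omega)).symm).symm
    · refine ⟨⟨b + 1, (h _ (hmax' _) (.refl _ _)).adj h13⟩, fun h5 => ⟨b, ?_⟩⟩
      have := h _ (hmax' _) (Or.inr (hadj b))
      exact this.adj (hc.cyclicVert_ne b (d := 3) (by omega) (by omega))
  constructor
  · intro v c hc h4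
    obtain ⟨a, h⟩ := (key v c hc h4).1
    obtain ⟨i, j, hij, hj, ha, hd⟩ := c.exists_chord_of_adj_cyclicVert (by omega) (by omega) h
    exact ⟨i, j, hij, hj, ha, by omega⟩
  · intro v c hc _ h6
    obtain ⟨a, h⟩ := (key v c hc (by omega)).2 (by omega)
    obtain ⟨i, j, hij, hj, ha, hd⟩ := c.exists_chord_of_adj_cyclicVert (by omega) (by omega) h
    have : cycleDist c.length i j = 3 := by omega
    exact ⟨i, j, hij, hj, ha, by omega, by rw [this]; decide⟩

/-! ### Strongly chordal graphs are totally balanced -/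

/-- In a chordal graph, two neighbours of `x` joined by a path avoiding the other neighbours of `x`
are equal or adjacent. -/
theorem closedAdj_of_isChordal (hG : IsChordal G) {x : V} (n : ℕ) (g : ℕ → V)
    (hg : ∀ i < n, G.ClosedAdj (g i) (g (i + 1))) (h0 : G.Adj x (g 0)) (hn : G.Adj x (g n))
    (hx : ∀ i, 0 < i → i < n → ¬ G.ClosedAdj x (g i)) : G.ClosedAdj (g 0) (g n) := by
  induction n using Nat.strong_induction_on generalizing g with
  | _ n ih =>
  rcases n with _ | _ | n
  · exact .refl _ _
  · exact hg 0 (by omega)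
  -- A shortcut shortens the sequence, and induction applies. Without one, `x` and the sequence form
  -- a chordless cycle of length `n + 4`.
  by_cases hshort : ∃ a b, a + 2 ≤ b ∧ b ≤ n + 2 ∧ G.ClosedAdj (g a) (g b)
  · obtain ⟨a, b, hab, hb, hE⟩ := hshort
    by_cases hend : a = 0 ∧ b = n + 2
    · obtain ⟨rfl, rfl⟩ := hend
      exact hE
    set g' : ℕ → V := fun k => if k ≤ a then g k else g (k + (b - a - 1)) with hg'
    have h1 : ∀ k ≤ a, g' k = g k := fun k hk => by simp [hg', hk]
    have h2 : ∀ k, a < k → g' k = g (k + (b - a - 1)) := fun k hk => by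
      simp [hg', show ¬ k ≤ a by omega]
    have hlast : g' (n + 2 - (b - a - 1)) = g (n + 2) := by
      rw [h2 _ (by omega)]; congr 1; omega
    have := ih (n + 2 - (b - a - 1)) (by omega) g' (fun i hi => ?_) (by rwa [h1 0 (by omega)])
      (by rwa [hlast]) fun i hi0 hi => ?_
    · rwa [hlast, h1 0 (by omega)] at this
    · rcases lt_trichotomy i a with h | rfl | h
      · rw [h1 i h.le, h1 (i + 1) (by omega)]; exact hg i (by omega)
      · rw [h1 i le_rfl, h2 (i + 1) (by omega), show i + 1 + (b - i - 1) = b by omega]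
        exact hE
      · rw [h2 i h, h2 (i + 1) (by omega), show i + 1 + (b - a - 1) = i + (b - a - 1) + 1 by omega]
        exact hg _ (by omega)
    · by_cases h : i ≤ a
      · rw [h1 i h]; exact hx i hi0 (by omega)
      · rw [h2 i (by omega)]; exact hx _ (by omega) (by omega)
  · push Not at hshort
    exfalso
    have hne1 : ∀ a, a + 1 ≤ n + 2 → g a ≠ g (a + 1) := by
      intro a ha h
      by_cases h' : a + 2 ≤ n + 2
      · apply hshort a (a + 2) le_rfl h'
        rw [h]; exact hg _ (by omega)
      · obtain ⟨k, rfl⟩ : ∃ k, a = k + 1 := ⟨a - 1, by omega⟩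
        apply hshort k (k + 2) le_rfl (by omega)
        rw [← h]; exact hg _ (by omega)
    have hne : ∀ a b, a < b → b ≤ n + 2 → g a ≠ g b := by
      intro a b hab hb h
      rcases Nat.lt_or_ge b (a + 2) with h2 | h2
      · obtain rfl : b = a + 1 := by omega
        exact hne1 a hb h
      · exact hshort a b h2 hb (Or.inl h)
    have hxne : ∀ a ≤ n + 2, x ≠ g a := by
      intro a ha h
      rcases Nat.eq_zero_or_pos a with rfl | h0'
      · exact h0.ne h
      · rcases ha.lt_or_eq with h' | rfl
        · exact hx a h0' h' (Or.inl h)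
        · exact hn.ne h
    set f : ℕ → V := fun k => if k = 0 then x else g (k - 1) with hf
    have hfs : ∀ k, f (k + 1) = g k := fun k => by simp [hf]
    have hf0 : f 0 = x := by simp [hf]
    obtain ⟨v, c, hc, hlen, hcf⟩ := exists_isCycle_of_sequence (G := G) (f := f) (n := n + 4)
      (by omega)
      (fun i j hij hj => by
        obtain ⟨j, rfl⟩ : ∃ k, j = k + 1 := ⟨j - 1, by omega⟩
        rw [hfs]
        cases i with
        | zero => rw [hf0]; exact hxne _ (by omega)
        | succ i => rw [hfs]; exact hne _ _ (by omega) (by omega))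
      (fun i hi => by
        rw [hfs]
        cases i with
        | zero => rw [hf0]; exact h0
        | succ i => rw [hfs]; exact (hg i (by omega)).adj (hne1 i (by omega)))
      (by rw [hf0, show n + 4 - 1 = n + 2 + 1 by omega, hfs]; exact hn.symm)
    obtain ⟨i, j, hij, hj, hadj, hd⟩ := hG v c hc (by omega)
    rw [hlen] at hj hd
    unfold cycleDist at hd
    rw [hcf i (by omega), hcf j hj] at hadj
    obtain ⟨j, rfl⟩ : ∃ k, j = k + 1 := ⟨j - 1, by omega⟩
    rw [hfs] at hadj
    cases i with
    | zero =>
      rw [hf0] at hadj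
      exact hx j (by omega) (by omega) (Or.inr hadj)
    | succ i =>
      rw [hfs] at hadj
      exact hshort i j (by omega) (by omega) (Or.inr hadj)

/-- The closed neighbourhoods of a strongly chordal graph form a totally balanced family: the
alternating sequence of a chordless closed walk of the incidence relation does not exist. -/
theorem not_exists_alternating_cycle (hG : IsStronglyChordal G) {n : ℕ} (hn : 6 ≤ n) (hev : Even n)
    (f : ℕ → V) (hper : ∀ i, f (i + n) = f i)
    (hne : ∀ i k, 0 < k → k < n → Even k → f i ≠ f (i + k))
    (hodd : ∀ i k, k < n → Odd k → (G.ClosedAdj (f i) (f (i + k)) ↔ k = 1 ∨ k = n - 1)) :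
    False := by
  obtain ⟨m, hm⟩ := hev
  -- If `f i = f (i + 1)`, this vertex occurs at both parities, so `hodd` settles its closed
  -- adjacency to every other term. The remaining terms then join two of its neighbours while
  -- avoiding all others, and chordality makes these two closed adjacent, against `hodd`.
  by_cases hdist : ∃ i, f i = f (i + 1)
  · obtain ⟨i, hi⟩ := hdist
    have := closedAdj_of_isChordal hG.1 (x := f i) (n - 3) (fun k => f (i + 2 + k))
      (fun k hk => (hodd _ 1 (by omega) odd_one).2 (Or.inl rfl)) ?_ ?_ ?_
    · have h := (hodd (i + 2) (n - 3) (by omega) (by grind)).1 this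
      omega
    · refine ClosedAdj.adj ?_ (hne i 2 (by omega) (by omega) even_two)
      rw [hi]
      exact (hodd (i + 1) 1 (by omega) odd_one).2 (Or.inl rfl)
    · show G.Adj (f i) (f (i + 2 + (n - 3)))
      refine ClosedAdj.adj ?_ ?_
      · rw [show i + 2 + (n - 3) = i + (n - 1) by omega]
        exact (hodd i (n - 1) (by omega) (by grind)).2 (Or.inr rfl)
      · rw [hi, show i + 2 + (n - 3) = i + 1 + (n - 2) by omega]
        exact hne _ _ (by omega) (by omega) (by grind)
    · intro k hk0 hk
      show ¬ G.ClosedAdj (f i) (f (i + 2 + k))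
      rcases Nat.even_or_odd k with hk' | hk'
      · rw [hi, show i + 2 + k = i + 1 + (k + 1) by omega, hodd _ _ (by omega) (by grind)]
        omega
      · rw [show i + 2 + k = i + (k + 2) by omega, hodd _ _ (by omega) (by grind)]
        omega
  -- Now `f` runs through a genuine cycle of even length, where a chord of odd distance joins
  -- positions of different parity.
  · push Not at hdist
    have hadj : ∀ i, G.Adj (f i) (f (i + 1)) := fun i =>
      ((hodd i 1 (by omega) odd_one).2 (Or.inl rfl)).adj (hdist i)
    obtain ⟨v, c, hc, hlen, hcf⟩ := exists_isCycle_of_sequence (G := G) (f := f) (n := n)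
      (by omega)
      (fun i j hij hj => by
        obtain ⟨k, rfl⟩ : ∃ k, j = i + k := ⟨j - i, by omega⟩
        rcases Nat.even_or_odd k with hk | hk
        · exact hne i k (by omega) (by omega) hk
        · intro h
          rcases (hodd i k (by omega) hk).1 (Or.inl h) with rfl | rfl
          · exact hdist i h
          · apply hdist (i + (n - 1))
            rw [← h, show i + (n - 1) + 1 = i + n by omega, hper])
      (fun i _ => hadj i)
      (by
        have := hadj (n - 1)
        rwa [show n - 1 + 1 = 0 + n by omega, hper] at this)
    obtain ⟨i, j, hij, hj, ha, hd, hd'⟩ := hG.2 v c hc ⟨m, by omega⟩ (by omega)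
    rw [hlen] at hj hd hd'
    rw [hcf i (by omega), hcf j hj] at ha
    unfold cycleDist at hd hd'
    obtain ⟨k, rfl⟩ : ∃ k, j = i + k := ⟨j - i, by omega⟩
    have hk : Odd k := by
      rw [Nat.odd_iff] at hd' ⊢
      omega
    have := (hodd i k (by omega) hk).1 (Or.inr ha)
    omega

end SimpleGraph

/-! ### Lexicographic orderings are strong elimination orderings -/

namespace SimpleGraph

variable {V : Type*} {G : SimpleGraph V}

/-- With ones in both diagonal corners, the ones of the tridiagonal matrix trace a single chordless
cycle through all `2 * m + 2` rows and columns. -/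
theorem not_exists_closed_staircase (hG : IsStronglyChordal G) {m : ℕ} (hm : 2 ≤ m)
    {r c : ℕ → V} (hr : ∀ i j, i < j → j ≤ m → r i ≠ r j) (hc : ∀ i j, i < j → j ≤ m → c i ≠ c j)
    (hrc : ∀ i j, i ≤ m → j ≤ m → (G.ClosedAdj (r i) (c j) ↔
      i + 1 = j ∨ j + 1 = i ∨ (i = 0 ∧ j = 0) ∨ (i = m ∧ j = m))) : False := by
  -- The cycle descends from index `m` to `0`, alternating rows and columns, passes from `r 0` to `c
  -- 0`, and climbs back through the rows and columns not yet used.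
  set k : ℕ → ℕ := fun a => if a ≤ m then m - a else a - m - 1 with hk
  have hk1 : ∀ a, (a ≤ m ∧ k a + a = m) ∨ (m < a ∧ k a + m + 1 = a) := by
    intro a
    by_cases h : a ≤ m
    · have : k a = m - a := if_pos h
      omega
    · have : k a = a - m - 1 := if_neg h
      omega
  set h : ℕ → V := fun a => if Even (a + m) then r (k a) else c (k a) with hh
  have hr' : ∀ i j, i ≤ m → j ≤ m → i ≠ j → r i ≠ r j := by
    intro i j hi hj hij
    rcases lt_or_gt_of_ne hij with h | h
    · exact hr i j h hj
    · exact (hr j i h hi).symm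
  have hc' : ∀ i j, i ≤ m → j ≤ m → i ≠ j → c i ≠ c j := by
    intro i j hi hj hij
    rcases lt_or_gt_of_ne hij with h | h
    · exact hc i j h hj
    · exact (hc j i h hi).symm
  have hsame : ∀ a b, a < 2 * m + 2 → b < 2 * m + 2 → a ≠ b → Even (a + b) → h a ≠ h b := by
    intro a b ha hb hab hev
    have h1 := hk1 a
    have h2 := hk1 b
    rw [Nat.even_iff] at hev
    have hkne : k a ≠ k b := by omega
    by_cases hp : Even (a + m)
    · have hp' : Even (b + m) := by rw [Nat.even_iff] at *; omega
      simp only [hh, hp, hp', if_true]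
      exact hr' _ _ (by omega) (by omega) hkne
    · have hp' : ¬ Even (b + m) := by rw [Nat.even_iff] at *; omega
      simp only [hh, hp, hp', if_false]
      exact hc' _ _ (by omega) (by omega) hkne
  have hdiff : ∀ a b, a < b → b < 2 * m + 2 → Odd (a + b) →
      (G.ClosedAdj (h a) (h b) ↔ b = a + 1 ∨ (a = 0 ∧ b = 2 * m + 1)) := by
    intro a b hab hb hev
    have h1 := hk1 a
    have h2 := hk1 b
    rw [Nat.odd_iff] at hev
    by_cases hp : Even (a + m)
    · have hp' : ¬ Even (b + m) := by rw [Nat.even_iff] at *; omega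
      simp only [hh, hp, hp', if_true, if_false]
      rw [hrc _ _ (by omega) (by omega)]
      omega
    · have hp' : Even (b + m) := by rw [Nat.even_iff] at *; omega
      simp only [hh, hp, hp', if_true, if_false]
      rw [closedAdj_comm, hrc _ _ (by omega) (by omega)]
      omega
  refine not_exists_alternating_cycle hG (n := 2 * m + 2) (by omega) ⟨m + 1, by omega⟩
    (fun i => h (i % (2 * m + 2))) (by simp) ?_ ?_
  · intro i d hd0 hd hev
    have h1 := Nat.mod_lt i (show 0 < 2 * m + 2 by omega)
    have h2 := Nat.mod_lt (i + d) (show 0 < 2 * m + 2 by omega)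
    have h3 := mod_add_cases (show 0 < 2 * m + 2 by omega) i d hd
    rw [Nat.even_iff] at hev
    exact hsame _ _ h1 h2 (by omega) (by rw [Nat.even_iff]; omega)
  · intro i d hd hodd
    have h1 := Nat.mod_lt i (show 0 < 2 * m + 2 by omega)
    have h2 := Nat.mod_lt (i + d) (show 0 < 2 * m + 2 by omega)
    rw [Nat.odd_iff] at hodd
    rcases mod_add_cases (show 0 < 2 * m + 2 by omega) i d hd with ⟨h3, h4⟩ | ⟨h3, h4⟩
    · rw [hdiff _ _ (by omega) h2 (by rw [Nat.odd_iff]; omega)]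
      omega
    · rw [closedAdj_comm, hdiff _ _ (by omega) h1 (by rw [Nat.odd_iff]; omega)]
      omega

/-- The closed neighbourhoods are ordered lexicographically by the ordering `p`, the largest
element being the most significant one. -/
def IsLexOrdering (G : SimpleGraph V) (p : V → ℕ) : Prop :=
  ∀ a b, p a < p b → ∀ c, G.ClosedAdj a c → ¬ G.ClosedAdj b c →
    ∃ c', p c < p c' ∧ ¬ G.ClosedAdj a c' ∧ G.ClosedAdj b c' ∧
      ∀ d, p c' < p d → (G.ClosedAdj a d ↔ G.ClosedAdj b d)

/-- Two increasing sequences `r` and `c` whose incidence matrix is tridiagonal, with zeros on the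
diagonal except for the first entry, and such that the rows (the columns) agree beyond the last
column (the last row). -/
structure IsStaircase (G : SimpleGraph V) (p : V → ℕ) (r c : ℕ → V) (n : ℕ) : Prop where
  row_lt : ∀ i < n, p (r i) < p (r (i + 1))
  col_lt : ∀ i < n, p (c i) < p (c (i + 1))
  closedAdj_iff : ∀ i j, i ≤ n → j ≤ n → (G.ClosedAdj (r i) (c j) ↔
    i + 1 = j ∨ j + 1 = i ∨ (i = 0 ∧ j = 0))
  row_agree : ∀ i < n, ∀ d, p (c n) < p d → (G.ClosedAdj (r i) d ↔ G.ClosedAdj (r (n - 1)) d)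
  col_agree : ∀ i < n, ∀ d, p (r n) < p d → (G.ClosedAdj (c i) d ↔ G.ClosedAdj (c (n - 1)) d)

theorem lt_of_forall_lt_succ {q : ℕ → ℕ} {n : ℕ} (h : ∀ i < n, q i < q (i + 1)) {i j : ℕ}
    (hij : i < j) (hj : j ≤ n) : q i < q j := by
  induction j, hij using Nat.le_induction with
  | base => exact h i (by omega)
  | succ j _ ih => exact (ih (by omega)).trans (h j (by omega))

/-- Rows `r (n - 1)` and `r n` differ at `c n` in the wrong direction, so a later column `y` must
compensate; by `row_agree` all earlier rows vanish there too. Symmetrically there is a new row `x`.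
The new corner entry is zero, as otherwise the staircase would close up. -/
theorem IsStaircase.exists_succ (hG : IsStronglyChordal G) {p : V → ℕ} (hp : G.IsLexOrdering p)
    {r c : ℕ → V} {n : ℕ} (hn : 1 ≤ n) (h : G.IsStaircase p r c n) :
    ∃ r' c', G.IsStaircase p r' c' (n + 1) := by
  have hnn : ¬ G.ClosedAdj (r n) (c n) := by
    rw [h.closedAdj_iff n n le_rfl le_rfl]; omega
  have hrn := h.row_lt (n - 1) (by omega)
  have hcn := h.col_lt (n - 1) (by omega)
  rw [Nat.sub_add_cancel hn] at hrn hcn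
  obtain ⟨y, hy, hy1, hy2, hy3⟩ := hp _ _ hrn (c n)
    ((h.closedAdj_iff _ _ (by omega) le_rfl).2 (by omega)) hnn
  obtain ⟨x, hx, hx1, hx2, hx3⟩ := hp _ _ hcn (r n)
    (((h.closedAdj_iff _ _ le_rfl (by omega)).2 (by omega)).symm) (mt ClosedAdj.symm hnn)
  set r' : ℕ → V := fun i => if i ≤ n then r i else x with hr'
  set c' : ℕ → V := fun i => if i ≤ n then c i else y with hc'
  have r1 : ∀ i ≤ n, r' i = r i := fun i hi => by simp [hr', hi]
  have r2 : r' (n + 1) = x := by simp [hr']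
  have c1 : ∀ i ≤ n, c' i = c i := fun i hi => by simp [hc', hi]
  have c2 : c' (n + 1) = y := by simp [hc']
  have hrlt : ∀ i < n + 1, p (r' i) < p (r' (i + 1)) := by
    intro i hi
    rcases Nat.lt_succ_iff_lt_or_eq.1 hi with h' | rfl
    · rw [r1 i h'.le, r1 (i + 1) h']; exact h.row_lt i h'
    · rw [r1 i le_rfl, r2]; exact hx
  have hclt : ∀ i < n + 1, p (c' i) < p (c' (i + 1)) := by
    intro i hi
    rcases Nat.lt_succ_iff_lt_or_eq.1 hi with h' | rfl
    · rw [c1 i h'.le, c1 (i + 1) h']; exact h.col_lt i h'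
    · rw [c1 i le_rfl, c2]; exact hy
  have hiff : ∀ i j, i ≤ n + 1 → j ≤ n + 1 → ¬ (i = n + 1 ∧ j = n + 1) →
      (G.ClosedAdj (r' i) (c' j) ↔ i + 1 = j ∨ j + 1 = i ∨ (i = 0 ∧ j = 0)) := by
    intro i j hi hj hij
    rcases hi.lt_or_eq with hi' | rfl
    · rcases hj.lt_or_eq with hj' | rfl
      · rw [r1 i (by omega), c1 j (by omega)]
        exact h.closedAdj_iff i j (by omega) (by omega)
      · rw [r1 i (by omega), c2]
        rcases Nat.lt_succ_iff_lt_or_eq.1 hi' with h' | rfl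
        · rw [h.row_agree i h' y hy]
          exact iff_of_false hy1 (by omega)
        · exact iff_of_true hy2 (by omega)
    · rw [c1 j (by omega), r2, closedAdj_comm]
      rcases Nat.lt_or_ge j n with h' | h'
      · rw [h.col_agree j h' x hx]
        exact iff_of_false hx1 (by omega)
      · obtain rfl : j = n := by omega
        exact iff_of_true hx2 (by omega)
  have hlast : ¬ G.ClosedAdj (r' (n + 1)) (c' (n + 1)) := by
    intro hE
    refine not_exists_closed_staircase hG (m := n + 1) (by omega) (r := r') (c := c')
      (fun i j hij hj he => (lt_of_forall_lt_succ hrlt hij hj).ne (by rw [he]))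
      (fun i j hij hj he => (lt_of_forall_lt_succ hclt hij hj).ne (by rw [he])) ?_
    intro i j hi hj
    by_cases hij : i = n + 1 ∧ j = n + 1
    · obtain ⟨rfl, rfl⟩ := hij
      exact iff_of_true hE (by omega)
    · rw [hiff i j hi hj hij]
      omega
  refine ⟨r', c', hrlt, hclt, ?_, ?_, ?_⟩
  · intro i j hi hj
    by_cases hij : i = n + 1 ∧ j = n + 1
    · obtain ⟨rfl, rfl⟩ := hij
      exact iff_of_false hlast (by omega)
    · exact hiff i j hi hj hij
  · intro i hi d hd
    rw [c2] at hd
    rw [Nat.add_sub_cancel, r1 n le_rfl, r1 i (by omega)]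
    rcases Nat.lt_succ_iff_lt_or_eq.1 hi with h' | rfl
    · rw [h.row_agree i h' d (hy.trans hd), hy3 d hd]
    · rfl
  · intro i hi d hd
    rw [r2] at hd
    rw [Nat.add_sub_cancel, c1 n le_rfl, c1 i (by omega)]
    rcases Nat.lt_succ_iff_lt_or_eq.1 hi with h' | rfl
    · rw [h.col_agree i h' d (hx.trans hd), hx3 d hd]
    · rfl

/-- A lexicographic ordering of a strongly chordal graph is a strong elimination ordering. -/
theorem IsLexOrdering.closedAdj [Finite V] (hG : IsStronglyChordal G) {p : V → ℕ}
    (hp : G.IsLexOrdering p) {i j k l : V} (hij : p i < p j) (hkl : p k < p l)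
    (hik : G.ClosedAdj i k) (hil : G.ClosedAdj i l) (hjk : G.ClosedAdj j k) :
    G.ClosedAdj j l := by
  by_contra hjl
  -- The forbidden submatrix is a staircase with `n = 1`. Longer ones would need strictly
  -- increasing, hence unbounded, values of `p`.
  have hstair : ∀ n, ∃ r c, G.IsStaircase p r c (n + 1) := by
    intro n
    induction n with
    | zero =>
      refine ⟨fun a => if a = 0 then i else j, fun a => if a = 0 then k else l, ?_, ?_, ?_, ?_, ?_⟩
      · simpa using hij
      · simpa using hkl
      · intro a b ha hb
        interval_cases a <;> interval_cases b <;> simp [hik, hil, hjk, hjl]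
      · simp
      · simp
    | succ n ih =>
      obtain ⟨r, c, h⟩ := ih
      exact h.exists_succ hG hp (by omega)
  obtain ⟨B, hB⟩ := (Set.finite_range p).bddAbove
  obtain ⟨r, c, h⟩ := hstair B
  have hge : ∀ a ≤ B + 1, a ≤ p (r a) := by
    intro a
    induction a with
    | zero => simp
    | succ a ih =>
      intro ha
      have := h.row_lt a (by omega)
      have := ih (by omega)
      omega
  have := hge (B + 1) le_rfl
  have := hB (Set.mem_range_self (r (B + 1)))
  omega

/-! ### Existence of a lexicographic ordering -/

section Fintype

variable [Fintype V]

open Matrix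

theorem dotProduct_mulVec_add_smul_single_sub_single {M : Matrix V V ℤ} (hM : M.IsSymm) [DecidableEq V] (x : V → ℤ)
    (a b : V) (t : ℤ) :
    (x + t • (Pi.single a 1 - Pi.single b 1)) ⬝ᵥ
        (M *ᵥ (x + t • (Pi.single a 1 - Pi.single b 1))) =
      x ⬝ᵥ (M *ᵥ x) + 2 * t * ((M *ᵥ x) a - (M *ᵥ x) b) +
        t ^ 2 * (M a a + M b b - 2 * M a b) := by
  have hs : ∀ c, x ⬝ᵥ M.col c = (M *ᵥ x) c := by
    intro c
    rw [dotProduct_comm]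
    simp only [mulVec, dotProduct, col_apply]
    exact Finset.sum_congr rfl fun d _ => by rw [hM.apply]
  simp only [mulVec_add, mulVec_smul, mulVec_sub, mulVec_single_one, dotProduct_add,
    add_dotProduct, dotProduct_smul, smul_dotProduct, sub_dotProduct, dotProduct_sub,
    single_one_dotProduct, hs, col_apply, smul_eq_mul, hM.apply b a]
  have : M b a = M a b := hM.apply a b
  rw [this]
  ring

/-- For an ordering maximising `wᵀ M w`, exchanging `a` and `b` with `p a < p b` cannot increase the
form, which forces `(M w) a ≤ (M w) b`. These are the numbers whose binary digits encode the closed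
neighbourhoods, so comparing them is comparing lexicographically. -/
theorem exists_isLexOrdering (G : SimpleGraph V) :
    ∃ p : V ≃ Fin (Fintype.card V), G.IsLexOrdering fun v => (p v : ℕ) := by
  classical
  set M : Matrix V V ℤ := Matrix.of fun u v => if G.ClosedAdj u v then 1 else 0 with hMdef
  have hM : M.IsSymm := by
    ext u v
    simp [hMdef, closedAdj_comm (u := u)]
  set w : (V ≃ Fin (Fintype.card V)) → V → ℤ := fun p v => 2 ^ (p v : ℕ) with hw
  have : Nonempty (V ≃ Fin (Fintype.card V)) := ⟨Fintype.equivFin V⟩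
  obtain ⟨p, hp⟩ := Finite.exists_max fun p => w p ⬝ᵥ (M *ᵥ w p)
  set s : V → Finset ℕ := fun a => ({u | G.ClosedAdj a u} : Finset V).image fun u => (p u : ℕ)
    with hs
  have hmem : ∀ a d, (p d : ℕ) ∈ s a ↔ G.ClosedAdj a d := by
    intro a d
    simp [hs, Fin.val_inj]
  have hsum : ∀ a, (M *ᵥ w p) a = ((∑ k ∈ s a, 2 ^ k : ℕ) : ℤ) := by
    intro a
    rw [Finset.sum_image (by intro x _ y _ h; exact p.injective (Fin.ext h))]
    simp [mulVec, dotProduct, hMdef, hw, Finset.sum_filter]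
  refine ⟨p, fun a b hab c hac hbc => ?_⟩
  have hne : a ≠ b := by rintro rfl; exact lt_irrefl _ hab
  have ht : (0 : ℤ) < 2 ^ (p b : ℕ) - 2 ^ (p a : ℕ) :=
    sub_pos.2 (pow_lt_pow_right₀ (by norm_num) hab)
  have hle : (M *ᵥ w p) a ≤ (M *ᵥ w p) b := by
    have hswap : w ((Equiv.swap a b).trans p) =
        w p + ((2 : ℤ) ^ (p b : ℕ) - 2 ^ (p a : ℕ)) • (Pi.single a 1 - Pi.single b 1) := by
      ext u
      rcases eq_or_ne u a with rfl | hua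
      · simp [hw, hne]
      rcases eq_or_ne u b with rfl | hub
      · simp [hw, hua]
      · simp [hw, hua, hub, Equiv.swap_apply_of_ne_of_ne]
    have := hp ((Equiv.swap a b).trans p)
    rw [hswap, dotProduct_mulVec_add_smul_single_sub_single hM] at this
    -- Closedness of the neighbourhoods matters here: it puts ones on the diagonal.
    have h1 : 0 ≤ M a a + M b b - 2 * M a b := by
      have : ∀ u, M u u = 1 := fun u => by simp [hMdef, ClosedAdj.refl]
      rw [this, this]
      simp only [hMdef, of_apply]
      split_ifs <;> norm_num
    nlinarith [mul_nonneg (sq_nonneg ((2 : ℤ) ^ (p b : ℕ) - 2 ^ (p a : ℕ))) h1]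
  rw [hsum, hsum, Nat.cast_le,
    Finset.geomSum_le_geomSum_iff_toColex_le_toColex le_rfl] at hle
  have hsne : s a ≠ s b := fun h => hbc ((hmem _ _).1 (h ▸ (hmem _ _).2 hac))
  obtain ⟨k, hk, hka⟩ := Finset.Colex.lt_iff_exists_filter_lt.1
    (lt_of_le_of_ne hle fun h => hsne (by simpa using h))
  rw [Finset.mem_sdiff] at hk
  obtain ⟨y, -, rfl⟩ := Finset.mem_image.1 hk.1
  have hagree : ∀ d, p y < p d → (G.ClosedAdj a d ↔ G.ClosedAdj b d) := by
    intro d hd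
    have := Finset.ext_iff.1 hka (p d : ℕ)
    simpa [hmem, hd] using this
  refine ⟨y, ?_, mt (hmem _ _).2 hk.2, (hmem _ _).1 hk.1, hagree⟩
  by_contra hcy
  rcases (not_lt.1 hcy).lt_or_eq with h | h
  · exact hbc ((hagree c h).1 hac)
  · obtain rfl := p.injective (Fin.ext h)
    exact hk.2 ((hmem _ _).2 hac)

end Fintype

end SimpleGraph

namespace SimpleGraph

variable {V : Type*} {G : SimpleGraph V}

theorem connected_of_rank {t : V} (f : V → ℕ) (h : ∀ v, v ≠ t → ∃ w, G.Adj v w ∧ f w < f v) :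
    G.Connected := by
  rw [connected_iff_exists_forall_reachable]
  refine ⟨t, fun v => ?_⟩
  induction hn : f v using Nat.strong_induction_on generalizing v with
  | _ n ih =>
    by_cases hv : v = t
    · rw [hv]
    · obtain ⟨w, hw, hlt⟩ := h v hv
      exact (ih _ (hn ▸ hlt) w rfl).trans hw.symm.reachable

end SimpleGraph

/-! ### Depth, parents and intersecting subtrees -/

namespace RootedWeightedTree

section

variable {N : Type*} (T : RootedWeightedTree N)

theorem isPath_pathToRoot (x : N) : (T.pathToRoot x).IsPath :=
  (T.isTree.existsUnique_path x T.root).choose_spec.1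

theorem eq_pathToRoot {x : N} {w : T.graph.Walk x T.root} (hw : w.IsPath) : w = T.pathToRoot x :=
  (T.isTree.existsUnique_path x T.root).unique hw (T.isPath_pathToRoot x)

theorem depth_eq_of_isPath {x : N} {w : T.graph.Walk x T.root} (hw : w.IsPath) :
    T.depth x = (w.edges.map T.weight).sum := by
  rw [depth, T.eq_pathToRoot hw]

/-- The first node after `x` on the path from `x` to the root, and the root if `x` is the root. -/
noncomputable def parent (x : N) : N := (T.pathToRoot x).snd

theorem parent_of_notMem_support {x y : N} (h : T.graph.Adj x y)
    (hx : x ∉ (T.pathToRoot y).support) : T.parent x = y ∧ T.depth y < T.depth x := by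
  have hpath : (SimpleGraph.Walk.cons h (T.pathToRoot y)).IsPath :=
    (T.isPath_pathToRoot y).cons hx
  constructor
  · rw [parent, ← T.eq_pathToRoot hpath, SimpleGraph.Walk.snd_cons]
  · rw [T.depth_eq_of_isPath hpath, SimpleGraph.Walk.edges_cons, List.map_cons, List.sum_cons]
    have := T.weight_pos s(x, y) h
    unfold depth
    omega

theorem parent_eq_or_parent_eq {x y : N} (h : T.graph.Adj x y) :
    T.parent x = y ∨ T.parent y = x := by
  by_cases hx : x ∈ (T.pathToRoot y).support
  · exact Or.inr (T.isTree.isAcyclic.eq_snd_of_adj_start (T.isPath_pathToRoot y) h.symm hx).symm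
  · exact Or.inl (T.parent_of_notMem_support h hx).1

theorem depth_parent_lt {x : N} (h : T.parent x ≠ x) : T.depth (T.parent x) < T.depth x := by
  have hnil : ¬ (T.pathToRoot x).Nil := fun hn => h <|
    ((T.pathToRoot x).getVert_of_length_le
      (by rw [SimpleGraph.Walk.length_eq_zero_iff.2 hn]; omega)).trans hn.eq.symm
  have hadj : T.graph.Adj x (T.parent x) := (T.pathToRoot x).adj_snd hnil
  have hpath := T.isPath_pathToRoot x
  rw [← (T.pathToRoot x).cons_tail_eq hnil, SimpleGraph.Walk.cons_isPath_iff] at hpath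
  refine (T.parent_of_notMem_support hadj ?_).2
  have := T.eq_pathToRoot hpath.1
  unfold parent
  rw [← this]
  exact hpath.2

theorem depth_iterate_parent_lt {x y : N} {k : ℕ} (h : T.parent^[k] y = x) (hne : y ≠ x) :
    T.depth x < T.depth y := by
  induction k generalizing y with
  | zero => exact absurd h hne
  | succ k ih =>
    rw [Function.iterate_succ_apply] at h
    by_cases hy : T.parent y = y
    · rw [hy] at h; exact ih h hne
    · have h1 := T.depth_parent_lt hy
      by_cases hy' : T.parent y = x
      · rwa [hy'] at h1
      · exact (ih h hy').trans h1

/-- A subtree contains the parents of its nodes other than the one closest to the root. -/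
theorem parent_mem_of_isSubtree {S : Set N} (hS : T.IsSubtree S) {r x : N} (hr : r ∈ S)
    (hmin : ∀ y ∈ S, T.depth r ≤ T.depth y) (hx : x ∈ S) (hxr : x ≠ r) :
    T.parent x ∈ S ∧ T.parent x ≠ x := by
  by_contra hcon
  -- Descendants of `x` can only be left through the edge from `x` to its parent. If that edge is
  -- missing in `S`, then `r` is a descendant of `x`, hence deeper than `x`.
  have hdesc : ∀ y z : S, (T.graph.induce S).Walk y z → (∃ k, T.parent^[k] y = x) →
      ∃ k, T.parent^[k] z = x := by
    intro y z w
    induction w with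
    | nil => exact id
    | @cons y z _ h _ ih =>
      rintro ⟨k, hk⟩
      apply ih
      rcases T.parent_eq_or_parent_eq (show T.graph.Adj y z from h) with h' | h'
      · cases k with
        | zero =>
          have hy : (y : N) = x := hk
          rw [hy] at h'
          have : T.parent x = x := by
            by_contra hne
            exact hcon ⟨h' ▸ z.2, hne⟩
          exact ⟨0, by rw [Function.iterate_zero_apply, ← h', this]⟩
        | succ k => exact ⟨k, by rw [← h', ← Function.iterate_succ_apply, hk]⟩
      · exact ⟨k + 1, by rw [Function.iterate_succ_apply, h', hk]⟩
  obtain ⟨w⟩ := hS.connected.preconnected ⟨x, hx⟩ ⟨r, hr⟩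
  obtain ⟨k, hk⟩ := hdesc _ _ w ⟨0, rfl⟩
  exact absurd (T.depth_iterate_parent_lt hk hxr.symm) (hmin x hx).not_gt

theorem exists_min_depth {S : Set N} (hS : T.IsSubtree S) :
    ∃ r ∈ S, ∀ y ∈ S, T.depth r ≤ T.depth y := by
  have hne : S.Nonempty := Set.nonempty_coe_sort.1 hS.connected.nonempty
  have := (measure T.depth).wf.has_min S hne
  obtain ⟨r, hr, h⟩ := this
  exact ⟨r, hr, fun y hy => not_lt.1 (h y hy)⟩

/-- If two subtrees meet, then the node of the first closest to the root belongs to the second,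
provided that it is not closer to the root than the corresponding node of the second. -/
theorem min_depth_mem_of_inter {S S' : Set N} (hS : T.IsSubtree S) (hS' : T.IsSubtree S')
    {r r' : N} (hr : r ∈ S) (hmin : ∀ y ∈ S, T.depth r ≤ T.depth y) (hr' : r' ∈ S')
    (hmin' : ∀ y ∈ S', T.depth r' ≤ T.depth y) (hle : T.depth r' ≤ T.depth r) {x : N}
    (hx : x ∈ S) (hx' : x ∈ S') : r ∈ S' := by
  induction hn : T.depth x using Nat.strong_induction_on generalizing x with
  | _ n ih =>
    by_cases h : x = r
    · exact h ▸ hx'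
    · obtain ⟨h1, h2⟩ := T.parent_mem_of_isSubtree hS hr hmin hx h
      have hlt := T.depth_parent_lt h2
      -- The climb towards `r` cannot get stuck at `r'`: the parent of `r'` would be a node of `S`
      -- above `r`.
      by_cases h' : x = r'
      · have := hmin _ h1
        rw [h'] at hlt this
        omega
      · exact ih _ (hn ▸ hlt) h1 (T.parent_mem_of_isSubtree hS' hr' hmin' hx' h').1 rfl

/-- Neighbours `u`, `w` of `v` whose tops are no deeper than `r v` both contain `r v`. If `R u`
overshadows `R w`, then all nodes of `R w` down to that depth lie in `R u`; among them is the deeper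
of `r x` and `r w` for each `x` closed adjacent to `w` of rank at most that of `v`. -/
theorem isStronglyChordal_of_isTreeRepresentation {V : Type*} {G : SimpleGraph V} {R : V → Set N}
    (hR : T.IsTreeRepresentation G R) (hcomp : T.IsCompatible R) : IsStronglyChordal G := by
  obtain ⟨hsub, hadj⟩ := hR
  choose r hr hmin using fun v => T.exists_min_depth (hsub v)
  have hE : ∀ u v, G.ClosedAdj u v ↔ (R u ∩ R v).Nonempty := by
    intro u v
    rw [SimpleGraph.ClosedAdj, hadj]
    by_cases h : u = v
    · subst h
      simpa using ⟨r u, hr u⟩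
    · simp [h]
  have hmem : ∀ u v, G.ClosedAdj u v → T.depth (r u) ≤ T.depth (r v) → r v ∈ R u := by
    intro u v h hle
    obtain ⟨x, hx⟩ := (hE u v).1 h
    exact T.min_depth_mem_of_inter (hsub v) (hsub u) (hr v) (hmin v) (hr u) (hmin u) hle hx.2 hx.1
  have key : ∀ v u w, G.Adj v u → G.Adj v w → T.depth (r u) ≤ T.depth (r v) →
      T.depth (r w) ≤ T.depth (r v) → T.Overshadows (R u) (R w) →
      ∀ x, T.depth (r x) ≤ T.depth (r v) → G.ClosedAdj x w → G.ClosedAdj x u := by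
    intro v u w hvu hvw hu hw hov x hx hxw
    have hvu' := hmem u v (Or.inr hvu.symm) hu
    have hvw' := hmem w v (Or.inr hvw.symm) hw
    have hov' : ∀ y ∈ R w, T.depth y ≤ T.depth (r v) → y ∈ R u := by
      intro y hy hle
      by_contra hyu
      exact absurd (hov y ⟨hy, hyu⟩ (r v) ⟨hvw', hvu'⟩) hle.not_gt
    rw [hE]
    rcases le_total (T.depth (r w)) (T.depth (r x)) with h | h
    · exact ⟨r x, hr x, hov' _ (hmem w x hxw.symm h) hx⟩
    · exact ⟨r w, hmem x w hxw h, hov' _ (hr w) hw⟩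
  refine SimpleGraph.isStronglyChordal_of_rank (f := fun v => T.depth (r v)) ?_
  intro v u w hvu hvw hu hw
  exact (hcomp u w).imp (key v u w hvu hvw hu hw) (key v w u hvw hvu hw hu)

end

/-! ### Trees given by a parent map -/

section OfParent

variable {n : ℕ} {par : Fin (n + 1) → Fin (n + 1)}

/-- The tree in which `par i` is the parent of every node `i` but the last one, the root. -/
def parentGraph (par : Fin (n + 1) → Fin (n + 1)) (h : ∀ i, i ≠ Fin.last n → i < par i) :
    SimpleGraph (Fin (n + 1)) where
  Adj i j := (i ≠ Fin.last n ∧ par i = j) ∨ (j ≠ Fin.last n ∧ par j = i)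
  symm := ⟨fun _ _ => Or.symm⟩
  loopless := ⟨fun i hi => by
    rcases hi with hi | hi <;> exact (h i hi.1).ne hi.2.symm⟩

theorem parentGraph_isTree (h : ∀ i, i ≠ Fin.last n → i < par i) : (parentGraph par h).IsTree where
  connected := SimpleGraph.connected_of_rank (t := Fin.last n) (fun i => n - (i : ℕ)) fun i hi =>
    ⟨par i, Or.inl ⟨hi, rfl⟩, by
      have h1 : (i : ℕ) < par i := h i hi
      have := (par i).2
      show n - (par i : ℕ) < n - (i : ℕ)
      omega⟩
  isAcyclic := by
    refine SimpleGraph.isAcyclic_of_rank (f := fun i => (i : ℕ))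
      (fun i j hij he => hij.ne (Fin.ext he)) fun i j k hij hik hj hk => ?_
    have aux : ∀ j, (parentGraph par h).Adj i j → i < j → par i = j := by
      rintro j (hij | hij) hlt
      · exact hij.2
      · exact absurd (hij.2 ▸ h j hij.1) hlt.not_gt
    rw [← aux j hij hj, aux k hik hk]

/-- The tree `parentGraph par h`, weighted so that the depth of `i` is `n - i`. -/
def ofParent (par : Fin (n + 1) → Fin (n + 1)) (h : ∀ i, i ≠ Fin.last n → i < par i) :
    RootedWeightedTree (Fin (n + 1)) where
  graph := parentGraph par h
  isTree := parentGraph_isTree h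
  root := Fin.last n
  -- With truncated subtraction the sum is `|i - j|`, so the weights telescope along increasing
  -- paths.
  weight := Sym2.lift ⟨fun i j => ((i : ℕ) - j) + ((j : ℕ) - i), fun _ _ => Nat.add_comm _ _⟩
  weight_pos := by
    intro e
    induction e using Sym2.ind with
    | _ i j =>
      intro hij
      have : (i : ℕ) ≠ j := fun he => (show (parentGraph par h).Adj i j from hij).ne (Fin.ext he)
      show 0 < ((i : ℕ) - j) + ((j : ℕ) - i)
      omega

theorem depth_ofParent (h : ∀ i, i ≠ Fin.last n → i < par i) (i : Fin (n + 1)) :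
    (ofParent par h).depth i = n - i := by
  -- The bound on the support keeps the path simple when a smaller node is prepended.
  have key : ∀ m (i : Fin (n + 1)), n - (i : ℕ) = m →
      ∃ w : (ofParent par h).graph.Walk i (ofParent par h).root,
      w.IsPath ∧ (∀ x ∈ w.support, i ≤ x) ∧
        (w.edges.map (ofParent par h).weight).sum = m := by
    intro m
    induction m using Nat.strong_induction_on with
    | _ m ih =>
      intro i hi
      by_cases hlast : i = Fin.last n
      · subst hlast
        exact ⟨.nil, .nil, fun x hx => (SimpleGraph.Walk.mem_support_nil_iff.1 hx).ge,
          show 0 = m by simpa using hi⟩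
      · have hlt : (i : ℕ) < par i := h i hlast
        have hpn := (par i).2
        obtain ⟨w, hw, hge, hsum⟩ := ih (n - (par i : ℕ)) (by omega) (par i) rfl
        have hadj : (ofParent par h).graph.Adj i (par i) := Or.inl ⟨hlast, rfl⟩
        refine ⟨.cons hadj w, hw.cons fun hmem => (hge i hmem).not_gt hlt, ?_, ?_⟩
        · intro x hx
          rw [SimpleGraph.Walk.support_cons, List.mem_cons] at hx
          rcases hx with rfl | hx
          · exact le_rfl
          · exact (h i hlast).le.trans (hge x hx)
        · rw [SimpleGraph.Walk.edges_cons, List.map_cons, List.sum_cons, hsum]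
          show ((i : ℕ) - par i) + ((par i : ℕ) - i) + (n - (par i : ℕ)) = m
          omega
  obtain ⟨w, hw, -, hsum⟩ := key _ i rfl
  rw [depth_eq_of_isPath _ hw, hsum]

/-- Parent steps increase the number of a node and stay in `S`, so they can only end at `t`. -/
theorem isSubtree_ofParent (h : ∀ i, i ≠ Fin.last n → i < par i) {S : Set (Fin (n + 1))}
    {t : Fin (n + 1)} (ht : t ∈ S) (hS : ∀ i ∈ S, i ≠ t → i ≠ Fin.last n ∧ par i ∈ S) :
    (ofParent par h).IsSubtree S where
  connected := SimpleGraph.connected_of_rank (t := ⟨t, ht⟩) (fun i => n - (i : ℕ)) fun i hi => by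
    obtain ⟨h1, h2⟩ := hS i i.2 fun he => hi (Subtype.ext he)
    refine ⟨⟨par i, h2⟩, Or.inl ⟨h1, rfl⟩, ?_⟩
    have h1 : ((i : Fin (n + 1)) : ℕ) < par i := h i h1
    have := (par i).2
    show n - (par i : ℕ) < n - ((i : Fin (n + 1)) : ℕ)
    omega
  isAcyclic := (parentGraph_isTree h).isAcyclic.induce S

end OfParent

end RootedWeightedTree

/-! ### Representations from strong elimination orderings -/

/-- A strong elimination ordering gives rise to a representation by compatible subtrees. -/
theorem exists_isTreeRepresentation_of_ordering {V : Type*} {G : SimpleGraph V} {n : ℕ}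
    (p : V ≃ Fin n) (hp : ∀ i j k l, p i < p j → p k < p l → G.ClosedAdj i k → G.ClosedAdj i l →
      G.ClosedAdj j k → G.ClosedAdj j l) :
    ∃ (T : RootedWeightedTree (Fin (n + 1))) (R : V → Set (Fin (n + 1))),
      T.IsTreeRepresentation G R ∧ T.IsCompatible R := by
  have hpar : ∀ i : Fin (n + 1), ∃ k, (i ≠ Fin.last n → i < k) ∧
      ∀ u v, i = (p u).castSucc → p u < p v → G.ClosedAdj u v →
        ∃ z, k = (p z).castSucc ∧ p u < p z ∧ p z ≤ p v ∧ G.ClosedAdj u z := by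
    intro i
    by_cases hex : ∃ u v, i = (p u).castSucc ∧ p u < p v ∧ G.ClosedAdj u v
    · obtain ⟨u, v, rfl, huv, hE⟩ := hex
      obtain ⟨z, ⟨hz1, hz2⟩, hmin⟩ := (measure fun v => (p v : ℕ)).wf.has_min
        {v | p u < p v ∧ G.ClosedAdj u v} ⟨v, huv, hE⟩
      refine ⟨(p z).castSucc, fun _ => Fin.castSucc_lt_castSucc_iff.2 hz1, ?_⟩
      intro u' v' hu' hlt hE'
      obtain rfl := p.injective (Fin.castSucc_injective _ hu')
      exact ⟨z, rfl, hz1, not_lt.1 (hmin v' ⟨hlt, hE'⟩), hz2⟩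
    · exact ⟨Fin.last n, Fin.lt_last_iff_ne_last.2, fun u v h1 h2 h3 =>
        absurd ⟨u, v, h1, h2, h3⟩ hex⟩
  choose par hlt hpar using hpar
  set R : V → Set (Fin (n + 1)) := fun v =>
    {i | ∃ u, i = (p u).castSucc ∧ p u ≤ p v ∧ G.ClosedAdj u v} with hR
  have hself : ∀ v, (p v).castSucc ∈ R v := fun v => ⟨v, rfl, le_rfl, .refl _ _⟩
  refine ⟨.ofParent par hlt, R, ⟨fun v => ?_, fun u v => ?_⟩, fun u v => ?_⟩
  · refine RootedWeightedTree.isSubtree_ofParent hlt (hself v) ?_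
    rintro _ ⟨u, rfl, huv, hE⟩ hne
    have hlt' : p u < p v := lt_of_le_of_ne huv fun h => hne (by rw [h])
    refine ⟨Fin.castSucc_ne_last _, ?_⟩
    obtain ⟨z, hz, huz, hzv, hE'⟩ := hpar _ u v rfl hlt' hE
    -- Both `z` and `v` are closed adjacent to the earlier `u`, so they are closed adjacent to each
    -- other.
    exact ⟨z, hz, hzv, hp u z u v huz hlt' (.refl _ _) hE hE'.symm⟩
  · constructor
    · intro h
      refine ⟨h.ne, ?_⟩
      rcases le_total (p u) (p v) with h' | h'
      · exact ⟨_, hself u, u, rfl, h', Or.inr h⟩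
      · exact ⟨_, ⟨v, rfl, h', Or.inr h.symm⟩, hself v⟩
    · rintro ⟨hne, _, ⟨x, rfl, hxu, hEu⟩, ⟨y, hxy, hxv, hEv⟩⟩
      obtain rfl := p.injective (Fin.castSucc_injective _ hxy)
      refine SimpleGraph.ClosedAdj.adj ?_ hne
      rcases hxu.eq_or_lt with h | h
      · exact p.injective h ▸ hEv
      rcases hxv.eq_or_lt with h' | h'
      · exact p.injective h' ▸ hEu.symm
      · exact hp x u x v h h' (.refl _ _) hEv hEu.symm
  -- The later vertex overshadows the earlier one: if `y` in both sets preceded a node `x` of `R u`,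
  -- the ones at `(y, u)`, `(y, v)`, `(x, u)` would put `x` into `R v`. So `x` precedes `y` and is
  -- deeper.
  · have key : ∀ u v, p u ≤ p v → (RootedWeightedTree.ofParent par hlt).Overshadows (R v) (R u) := by
      rintro u v huv _ ⟨⟨x, rfl, hxu, hEx⟩, hxv⟩ _ ⟨⟨y, rfl, hyu, hEy⟩, ⟨z, hyz, hyv, hEz⟩⟩
      obtain rfl := p.injective (Fin.castSucc_injective _ hyz)
      rw [RootedWeightedTree.depth_ofParent, RootedWeightedTree.depth_ofParent]
      rcases lt_trichotomy (p x) (p y) with h | h | h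
      · have h1 : (p x : ℕ) < p y := h
        have := (p y).2
        simp only [Fin.val_castSucc]
        omega
      · exact absurd ⟨y, by rw [h], hyv, hEz⟩ hxv
      · have hne : p u ≠ p v := fun h => hxv (p.injective h ▸ ⟨x, rfl, hxu, hEx⟩)
        exact absurd ⟨x, rfl, hxu.trans huv,
          hp y x u v h (lt_of_le_of_ne huv hne) hEy hEz hEx⟩ hxv
    exact (le_total (p v) (p u)).imp (key v u) (key u v)

theorem theorem1 {V : Type*} [Finite V] (G : SimpleGraph V) :
    IsStronglyChordal G ↔
      ∃ (N : Type) (_ : Finite N) (T : RootedWeightedTree N) (R : V → Set N),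
        T.IsTreeRepresentation G R ∧ T.IsCompatible R := by
  constructor
  · intro hG
    cases nonempty_fintype V
    obtain ⟨p, hp⟩ := SimpleGraph.exists_isLexOrdering G
    obtain ⟨T, R, h⟩ := exists_isTreeRepresentation_of_ordering p
      fun i j k l hij hkl => hp.closedAdj hG hij hkl
    exact ⟨_, inferInstance, T, R, h⟩
  · rintro ⟨N, -, T, R, hR, hcomp⟩
    exact T.isStronglyChordal_of_isTreeRepresentation hR hcomp
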